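/- Let $p(m)$ denote the number of partitions of the integer $m$, with $p(0)=1$ and $p(m)=0$ for $m<0$, and let $T_k = k(k+1)/2$ be the $k$-th triangular number. For integers $n \ge 0$ and $r \ge 1$, let $U_r(n)$ be the number of partitions of $n$ into parts not congruent to $0$, $r$ or $3r$ modulo $4r$. Then, for all integers $n\ge 0$ and $r\ge 1$, $$\sum_{k=0}^\infty (-1)^{T_k}\, p(n-rT_k) = U_r(n),$$ where only finitely many terms of the sum are nonzero. -/

import Mathlib

/-- The triangular number `T_k = k (k + 1) / 2` (the division is exact). -/
def triangular (k : ℕ) : ℕ := k * (k + 1) / 2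

/-- Euler's partition function on the integers: the number of partitions of `m`,
which is zero when `m` is negative. -/
def eulerPartition (m : ℤ) : ℕ :=
  if 0 ≤ m then Fintype.card (Nat.Partition m.toNat) else 0

/-- `U_r(n)`: the number of partitions of `n` all of whose parts are not congruent to
`0`, `r` or `3 r` modulo `4 r`. -/
def partitionsU (r n : ℕ) : ℕ :=
  (Nat.Partition.restricted n fun i : ℕ =>
    ¬ i ≡ 0 [MOD 4 * r] ∧ ¬ i ≡ r [MOD 4 * r] ∧ ¬ i ≡ 3 * r [MOD 4 * r]).card

/-! Put `q = X ^ r`. Multiplying the generating function of `U_r` by `∏ (1 - X ^ i)` leaves the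
factors of the forbidden parts, `∏ (1 - q ^ (2t+1)) (1 - q ^ (4t+4))`. Gauss' identity `∑ y ^ T_k =
∏ (1 - y ^ (2t+2)) / (1 - y ^ (2t+1))` at `y = -q` shows that this product is `∑ (-q) ^ T_k`
(`mk_card_restricted_mul_tprod`). Multiplying by the generating function of `p` and comparing
coefficients gives the claim. Gauss' identity is the limit of Shanks' finite form, which is proved
by telescoping. -/

theorem two_mul_triangular (k : ℕ) : 2 * triangular k = k * (k + 1) :=
  Nat.mul_div_cancel' (Nat.even_mul_succ_self k).two_dvd

theorem triangular_two_mul (n : ℕ) : triangular (2 * n) = n * (2 * n + 1) := by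
  have := two_mul_triangular (2 * n)
  nlinarith

theorem triangular_two_mul_add_one (n : ℕ) :
    triangular (2 * n + 1) = (n + 1) * (2 * n + 1) := by
  have := two_mul_triangular (2 * n + 1)
  nlinarith

theorem le_triangular (k : ℕ) : k ≤ triangular k := by
  have := two_mul_triangular k
  rcases k with _ | k
  · simp
  · nlinarith

section FiniteGauss

open Finset

variable {R : Type*} [CommRing R]

/-- The summand of Shanks' finite form of Gauss' triangular number identity, cleared of
denominators. -/
def shanksTerm (y : R) (n s : ℕ) : R :=
  (∏ t ∈ range s, (1 - y ^ (2 * t + 1))) * (∏ t ∈ Ico s n, (1 - y ^ (2 * t + 2))) *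
    y ^ (s * (2 * n + 1))

/-- The quantity whose differences are those of consecutive Shanks summands. -/
def shanksAux (y : R) (n s : ℕ) : R :=
  (∏ t ∈ range s, (1 - y ^ (2 * t + 1))) * (∏ t ∈ Ico s n, (1 - y ^ (2 * t + 2))) *
    (y ^ (s * (2 * n + 1)) * (1 - y ^ (2 * s)))

theorem shanksTerm_succ_sub (y : R) {n s : ℕ} (h : s < n) :
    shanksTerm y (n + 1) s - (1 - y ^ (2 * n + 1)) * shanksTerm y n s =
      shanksAux y n (s + 1) - shanksAux y n s := by
  rw [shanksTerm, shanksTerm, shanksAux, shanksAux, prod_Ico_succ_top h.le, prod_range_succ,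
    prod_eq_prod_Ico_succ_bot h]
  ring

/-- Boundary case of the telescoping: with `Ico (n + 1) n` empty, the factor `1 - y ^ (2 * n + 2)`
of `shanksAux y n (n + 1)` has to be dropped. -/
theorem shanksTerm_self_succ_sub (y : R) (n : ℕ) :
    shanksTerm y (n + 1) n - (1 - y ^ (2 * n + 1)) * shanksTerm y n n =
      (∏ t ∈ range (n + 1), (1 - y ^ (2 * t + 1))) * y ^ ((n + 1) * (2 * n + 1)) -
        shanksAux y n n := by
  rw [shanksTerm, shanksTerm, shanksAux, prod_Ico_succ_top le_rfl, prod_range_succ]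
  simp
  ring

/-- **Shanks' finite form of Gauss' triangular number identity**. -/
theorem prod_mul_sum_pow_triangular (y : R) (n : ℕ) :
    (∏ t ∈ range n, (1 - y ^ (2 * t + 1))) * ∑ k ∈ range (2 * n), y ^ triangular k =
      ∑ s ∈ range n, shanksTerm y n s := by
  induction n with
  | zero => simp
  | succ n ih =>
    have h : ∑ s ∈ range (n + 1),
        (shanksTerm y (n + 1) s - (1 - y ^ (2 * n + 1)) * shanksTerm y n s) =
        (∏ t ∈ range (n + 1), (1 - y ^ (2 * t + 1))) * y ^ ((n + 1) * (2 * n + 1)) := by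
      rw [sum_range_succ, sum_congr rfl fun s hs ↦ shanksTerm_succ_sub y (mem_range.mp hs),
        sum_range_sub (shanksAux y n), shanksTerm_self_succ_sub]
      -- The lower end `shanksAux y n 0` vanishes through its factor `1 - y ^ 0`.
      simp [shanksAux]
    rw [sum_sub_distrib, ← mul_sum, sum_range_succ (shanksTerm y n), ← ih, sub_eq_iff_eq_add] at h
    rw [h, show 2 * (n + 1) = 2 * n + 1 + 1 by ring, sum_range_succ, sum_range_succ,
      triangular_two_mul, triangular_two_mul_add_one, shanksTerm, prod_range_succ]
    simp
    ring

end FiniteGauss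

section PowerSeries

open Filter Finset PowerSeries PowerSeries.WithPiTopology Topology

theorem tendsto_zero_of_X_pow_dvd {R : Type*} [CommRing R] [TopologicalSpace R]
    {f : ℕ → R⟦X⟧} (h : ∀ n, (X : R⟦X⟧) ^ n ∣ f n) : Tendsto f atTop (𝓝 0) := by
  rw [tendsto_iff_coeff_tendsto]
  refine fun d ↦ tendsto_atTop_of_eventually_const (i₀ := d + 1) fun n hn ↦ ?_
  simpa using X_pow_dvd_iff.mp (h n) d (by omega)

theorem tendsto_order_of_X_pow_dvd {R : Type*} [CommRing R] {f : ℕ → R⟦X⟧}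
    (h : ∀ n, (X : R⟦X⟧) ^ n ∣ f n) : Tendsto (fun n ↦ (f n).order) atTop (𝓝 ⊤) := by
  refine ENat.tendsto_nhds_top_iff_natCast_lt.mpr fun n ↦ eventually_atTop.mpr ⟨n + 1, ?_⟩
  exact fun m hm ↦ lt_of_lt_of_le (Nat.cast_lt.mpr hm)
    (nat_le_order _ _ (X_pow_dvd_iff.mp (h m)))

theorem tendsto_prod_range_one_add_of_X_pow_dvd {f : ℕ → ℤ⟦X⟧}
    (h : ∀ n, (X : ℤ⟦X⟧) ^ n ∣ f n) :
    Tendsto (fun n ↦ ∏ i ∈ range n, (1 + f i)) atTop (𝓝 (∏' i, (1 + f i))) := by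
  exact (multipliable_one_add_of_tendsto_order_atTop_nhds_top ℤ
    (tendsto_order_of_X_pow_dvd h)).tendsto_prod_tprod_nat

theorem X_pow_dvd_neg_X_pow_pow {r : ℕ} (hr : 1 ≤ r) {m n : ℕ} (h : n ≤ m) :
    (X : ℤ⟦X⟧) ^ n ∣ (-(X : ℤ⟦X⟧) ^ r) ^ m := by
  rw [neg_pow, ← pow_mul]
  exact Dvd.dvd.mul_left (pow_dvd_pow _ (by nlinarith)) _

theorem summable_neg_X_pow_triangular {r : ℕ} (hr : 1 ≤ r) :
    Summable fun k ↦ (-(X : ℤ⟦X⟧) ^ r) ^ triangular k := by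
  exact summable_of_tendsto_order_atTop_nhds_top ℤ
    (tendsto_order_of_X_pow_dvd fun k ↦ X_pow_dvd_neg_X_pow_pow hr (le_triangular k))

/-- **Gauss' triangular number identity**, with `-X ^ r` as the variable. -/
theorem tprod_mul_tsum_neg_X_pow_triangular {r : ℕ} (hr : 1 ≤ r) :
    (∏' t, (1 + -(-(X : ℤ⟦X⟧) ^ r) ^ (2 * t + 1))) * ∑' k, (-(X : ℤ⟦X⟧) ^ r) ^ triangular k =
      ∏' t, (1 + -(-(X : ℤ⟦X⟧) ^ r) ^ (2 * t + 2)) := by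
  set y : ℤ⟦X⟧ := -(X : ℤ⟦X⟧) ^ r with hy
  have hD := tendsto_prod_range_one_add_of_X_pow_dvd (f := fun t ↦ -y ^ (2 * t + 1))
    fun n ↦ (X_pow_dvd_neg_X_pow_pow hr (by omega)).neg_right
  have hE := tendsto_prod_range_one_add_of_X_pow_dvd (f := fun t ↦ -y ^ (2 * t + 2))
    fun n ↦ (X_pow_dvd_neg_X_pow_pow hr (by omega)).neg_right
  have hS := (summable_neg_X_pow_triangular hr).tendsto_sum_tsum_nat.comp
    (tendsto_id.const_mul_atTop' (zero_lt_two (α := ℕ)))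
  refine tendsto_nhds_unique (hD.mul hS) ?_
  rw [← tendsto_sub_nhds_zero_iff] at hE ⊢
  rw [← zero_add (0 : ℤ⟦X⟧)]
  -- In Shanks' sum the term `s = 0` is the partial product on the right of Gauss' identity; the
  -- others are divisible by `y ^ (2 * n + 1)` and vanish in the limit.
  refine (hE.add (tendsto_zero_of_X_pow_dvd (R := ℤ)
    (f := fun n ↦ ∑ s ∈ range (n - 1), shanksTerm y n (s + 1)) fun n ↦ ?_)).congr' ?_
  · refine dvd_sum fun s _ ↦ ?_
    exact Dvd.dvd.mul_left (X_pow_dvd_neg_X_pow_pow hr (by nlinarith)) _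
  · filter_upwards [eventually_ge_atTop 1] with n hn
    have h := prod_mul_sum_pow_triangular y n
    obtain ⟨n, rfl⟩ := Nat.exists_eq_add_of_le' hn
    rw [sum_range_succ'] at h
    simp only [← sub_eq_add_neg, Function.comp_apply, id]
    rw [h]
    simp [shanksTerm]
    ring

/-- Pair `(1 + x ^ (2t+1)) (1 - x ^ (2t+1)) = 1 - x ^ (4t+2)`; with the `1 - x ^ (4t+4)` these give
all even exponents. -/
theorem prod_mul_prod_mul_prod_eq_prod_range_two_mul {R : Type*} [CommRing R] (x : R) (n : ℕ) :
    (∏ t ∈ range n, (1 + -(-x) ^ (2 * t + 1))) *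
      ((∏ t ∈ range n, (1 + -x ^ (2 * t + 1))) * ∏ t ∈ range n, (1 + -x ^ (4 * t + 4))) =
        ∏ t ∈ range (2 * n), (1 + -(-x) ^ (2 * t + 2)) := by
  induction n with
  | zero => simp
  | succ n ih =>
    rw [show 2 * (n + 1) = 2 * n + 1 + 1 by ring, prod_range_succ _ (2 * n + 1),
      prod_range_succ _ (2 * n), ← ih]
    have h1 : Odd (2 * n + 1) := odd_two_mul_add_one n
    have h2 : Even (2 * (2 * n) + 2) := ⟨2 * n + 1, by ring⟩
    have h3 : Even (2 * (2 * n + 1) + 2) := ⟨2 * n + 2, by ring⟩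
    rw [prod_range_succ, prod_range_succ, prod_range_succ, h1.neg_pow, h2.neg_pow, h3.neg_pow]
    ring

/-- `i` is congruent to none of `0`, `r`, `3 r` modulo `4 r`. -/
abbrev IsAllowedPart (r i : ℕ) : Prop :=
  ¬ i ≡ 0 [MOD 4 * r] ∧ ¬ i ≡ r [MOD 4 * r] ∧ ¬ i ≡ 3 * r [MOD 4 * r]

theorem filter_not_isAllowedPart {r : ℕ} (hr : 1 ≤ r) (n : ℕ) :
    {i ∈ range (4 * r) | ¬ IsAllowedPart r (4 * r * n + i + 1)} =
      {r - 1, 3 * r - 1, 4 * r - 1} := by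
  ext i
  have key (a : ℕ) : 4 * r * n + i + 1 ≡ a [MOD 4 * r] ↔ i + 1 ≡ a [MOD 4 * r] := by
    rw [Nat.ModEq, Nat.ModEq, add_assoc, Nat.mul_add_mod]
  simp only [mem_filter, mem_range, mem_insert, mem_singleton, IsAllowedPart, key]
  have h1 : r % (4 * r) = r := Nat.mod_eq_of_lt (by omega)
  have h2 : 3 * r % (4 * r) = 3 * r := Nat.mod_eq_of_lt (by omega)
  simp only [Nat.ModEq, h1, h2, Nat.zero_mod]
  rcases lt_trichotomy (i + 1) (4 * r) with h | h | h
  · rw [Nat.mod_eq_of_lt h]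
    omega
  · rw [h, Nat.mod_self]
    omega
  · omega

/-- Each block of `4 * r` consecutive parts contains three forbidden ones: `r (4n+1)`, `r (4n+3)`
and `r (4n+4)`. -/
theorem prod_range_ite_isAllowedPart {R : Type*} [CommRing R] {r : ℕ} (hr : 1 ≤ r) (x : R)
    (n : ℕ) :
    ∏ i ∈ range (4 * r * n), (if IsAllowedPart r (i + 1) then 1 else 1 - x ^ (i + 1)) =
      (∏ t ∈ range (2 * n), (1 + -(x ^ r) ^ (2 * t + 1))) *
        ∏ t ∈ range n, (1 + -(x ^ r) ^ (4 * t + 4)) := by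
  induction n with
  | zero => simp
  | succ n ih =>
    rw [mul_add_one, prod_range_add, ih, prod_ite, prod_const_one, one_mul,
      filter_not_isAllowedPart hr, prod_insert (by simp; omega), prod_insert (by simp; omega),
      prod_singleton, show 2 * (n + 1) = 2 * n + 1 + 1 by ring, prod_range_succ,
      prod_range_succ _ (2 * n), prod_range_succ _ n]
    have e1 : 4 * r * n + (r - 1) + 1 = r * (2 * (2 * n) + 1) := by
      rw [add_assoc, Nat.sub_add_cancel hr]; ring
    have e2 : 4 * r * n + (3 * r - 1) + 1 = r * (2 * (2 * n + 1) + 1) := by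
      rw [add_assoc, Nat.sub_add_cancel (by omega)]; ring
    have e3 : 4 * r * n + (4 * r - 1) + 1 = r * (4 * n + 4) := by
      rw [add_assoc, Nat.sub_add_cancel (by omega)]; ring
    rw [e1, e2, e3]
    simp only [pow_mul x r]
    ring

/-- Each allowed part contributes a geometric series, cancelled by its factor `1 - X ^ (i + 1)`. -/
theorem hasProd_mk_card_restricted_mul (p : ℕ → Prop) [DecidablePred p] :
    HasProd (fun i ↦ if p (i + 1) then 1 else 1 - (X : ℤ⟦X⟧) ^ (i + 1))
      (PowerSeries.mk (fun n ↦ (#(Nat.Partition.restricted n p) : ℤ)) *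
        ∏' i, (1 - (X : ℤ⟦X⟧) ^ (i + 1))) := by
  convert! (Nat.Partition.hasProd_powerSeriesMk_card_restricted ℤ p).mul
    (multipliable_one_sub_X_pow ℤ).hasProd using 1
  ext1 i
  split_ifs
  · simp_rw [pow_mul]
    rw [tsum_pow_mul_one_sub_of_constantCoeff_eq_zero (by simp)]
  · rw [one_mul]

theorem X_pow_dvd_X_pow_pow {r : ℕ} (hr : 1 ≤ r) {m n : ℕ} (h : n ≤ m) :
    (X : ℤ⟦X⟧) ^ n ∣ ((X : ℤ⟦X⟧) ^ r) ^ m := by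
  rw [← pow_mul]
  exact pow_dvd_pow _ (by nlinarith)

theorem mk_card_restricted_mul_tprod {r : ℕ} (hr : 1 ≤ r) :
    PowerSeries.mk (fun n ↦ (#(Nat.Partition.restricted n (IsAllowedPart r)) : ℤ)) *
        ∏' i, (1 - (X : ℤ⟦X⟧) ^ (i + 1)) =
      ∑' k, (-(X : ℤ⟦X⟧) ^ r) ^ triangular k := by
  have hD := tendsto_prod_range_one_add_of_X_pow_dvd (f := fun t ↦ -(-X ^ r) ^ (2 * t + 1))
    fun n ↦ (X_pow_dvd_neg_X_pow_pow hr (by omega)).neg_right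
  have hE := tendsto_prod_range_one_add_of_X_pow_dvd (f := fun t ↦ -(-X ^ r) ^ (2 * t + 2))
    fun n ↦ (X_pow_dvd_neg_X_pow_pow hr (by omega)).neg_right
  have hW := tendsto_prod_range_one_add_of_X_pow_dvd (f := fun t ↦ -(X ^ r) ^ (2 * t + 1))
    fun n ↦ (X_pow_dvd_X_pow_pow hr (by omega)).neg_right
  have hV := tendsto_prod_range_one_add_of_X_pow_dvd (f := fun t ↦ -(X ^ r) ^ (4 * t + 4))
    fun n ↦ (X_pow_dvd_X_pow_pow hr (by omega)).neg_right
  have h2 : Tendsto (fun n : ℕ ↦ 2 * n) atTop atTop :=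
    tendsto_id.const_mul_atTop' zero_lt_two
  have h4 : Tendsto (fun n : ℕ ↦ 4 * r * n) atTop atTop :=
    tendsto_id.const_mul_atTop' (by omega)
  have hU := (hasProd_mk_card_restricted_mul (IsAllowedPart r)).tendsto_prod_nat.comp h4
  have hUWV := tendsto_nhds_unique hU (((hW.comp h2).mul hV).congr fun n ↦
    (prod_range_ite_isAllowedPart hr (X : ℤ⟦X⟧) n).symm)
  have hDWV := tendsto_nhds_unique (hE.comp h2) ((hD.mul (hW.mul hV)).congr fun n ↦
    prod_mul_prod_mul_prod_eq_prod_range_two_mul ((X : ℤ⟦X⟧) ^ r) n)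
  rw [hUWV]
  refine mul_left_cancel₀ ?_ (hDWV.symm.trans (tprod_mul_tsum_neg_X_pow_triangular hr).symm)
  -- The cancelled product is nonzero because its constant coefficient is 1.
  intro h0
  rw [h0] at hD
  have hc := tendsto_nhds_unique ((continuous_constantCoeff ℤ).tendsto _ |>.comp hD)
    (tendsto_const_nhds.congr (f₁ := fun _ ↦ (1 : ℤ)) fun n ↦ ?_)
  · simp at hc
  · simp [map_prod, show r ≠ 0 by omega]

theorem mk_card_partition_mul_tprod :
    PowerSeries.mk (fun n ↦ (Fintype.card (Nat.Partition n) : ℤ)) *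
      ∏' i, (1 - (X : ℤ⟦X⟧) ^ (i + 1)) = 1 := by
  have h := hasProd_mk_card_restricted_mul fun _ ↦ True
  simp only [if_true] at h
  simpa [Nat.Partition.restricted] using h.unique hasProd_one

theorem mk_card_restricted_eq_tsum_mul {r : ℕ} (hr : 1 ≤ r) :
    PowerSeries.mk (fun n ↦ (#(Nat.Partition.restricted n (IsAllowedPart r)) : ℤ)) =
      (∑' k, (-(X : ℤ⟦X⟧) ^ r) ^ triangular k) *
        PowerSeries.mk (fun n ↦ (Fintype.card (Nat.Partition n) : ℤ)) := by
  rw [← mk_card_restricted_mul_tprod hr, mul_assoc, mul_comm (∏' _, _),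
    mk_card_partition_mul_tprod, mul_one]

theorem coeff_neg_X_pow_pow_mul_mk_card_partition (r n m : ℕ) :
    coeff n ((-(X : ℤ⟦X⟧) ^ r) ^ m *
        PowerSeries.mk (fun n ↦ (Fintype.card (Nat.Partition n) : ℤ))) =
      (-1) ^ m * (eulerPartition ((n : ℤ) - (r : ℤ) * (m : ℤ)) : ℤ) := by
  have hC : ((-1 : ℤ⟦X⟧)) ^ m = C ((-1 : ℤ) ^ m) := by simp
  rw [neg_pow, hC, mul_assoc, coeff_C_mul, ← pow_mul, coeff_X_pow_mul', eulerPartition]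
  congr 1
  by_cases h : r * m ≤ n
  · have h' : (n : ℤ) - (r : ℤ) * (m : ℤ) = ((n - r * m : ℕ) : ℤ) := by push_cast [h]; rfl
    rw [if_pos h, h', if_pos (by positivity)]
    simp
  · rw [if_neg h, if_neg (by rw [sub_nonneg]; exact_mod_cast h)]
    simp

theorem hasSum_eulerPartition {r : ℕ} (hr : 1 ≤ r) (n : ℕ) :
    HasSum (fun k : ℕ ↦ (-1 : ℤ) ^ triangular k *
        (eulerPartition ((n : ℤ) - (r : ℤ) * (triangular k : ℤ)) : ℤ))
      (#(Nat.Partition.restricted n (IsAllowedPart r)) : ℤ) := by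
  have h := ((summable_neg_X_pow_triangular hr).hasSum.mul_right
    (PowerSeries.mk fun n ↦ (Fintype.card (Nat.Partition n) : ℤ))).map
      (coeff (R := ℤ) n) (continuous_coeff ℤ n)
  rw [← mk_card_restricted_eq_tsum_mul hr, coeff_mk] at h
  simpa only [Function.comp_def, coeff_neg_X_pow_pow_mul_mk_card_partition] using h

end PowerSeries

theorem mainTheorem4 (n r : ℕ) (hr : 1 ≤ r) :
    HasSum
      (fun k : ℕ => (-1 : ℤ) ^ triangular k *
        (eulerPartition ((n : ℤ) - (r : ℤ) * (triangular k : ℤ)) : ℤ))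
      (partitionsU r n : ℤ) :=
  hasSum_eulerPartition hr n
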